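/- Let $s\in(0,1)$. For disjoint measurable sets $A,B\subseteq\mathbb{R}^2$ put $I(A,B)=\iint_{A\times B}|x-y|^{-2-s}\,dx\,dy$, and for measurable $E\subseteq\mathbb{R}^2$ and a bounded set $\Omega\subset\mathbb{R}^2$ with Lipschitz boundary put $$\mathrm{Per}_s(E,\Omega)=I(E\cap\Omega,E^c\cap\Omega)+I(E\cap\Omega,E^c\cap\Omega^c)+I(E\cap\Omega^c,E^c\cap\Omega).$$ A measurable set $E$ is called $s$-minimal in $\Omega$ if $\mathrm{Per}_s(E,\Omega)\le\mathrm{Per}_s(G,\Omega)$ for every measurable $G\subseteq\mathbb{R}^2$ with $G\setminus\Omega=E\setminus\Omega$. Let $\lambda>0$. There exist $M_0>1$ and $\mu_0\in(0,1)$ (which may depend on $s$ and $\lambda$) such that the following holds for all $M\ge M_0$ and all $\mu\in(0,\mu_0]$. Let $F\subset\mathbb{R}^2$ be $s$-minimal in $(0,M)\times(-4,4)$, and suppose that, up to Lebesgue-null sets, $$F\cap\{x_1\in(-M,0)\}=\{x_2\le 0\}\cap\{x_1\in(-M,0)\}\quad\text{and}\quad \big((0,M)\times(-M,M)\big)\setminus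 F\subseteq\{x_1\in(0,\mu)\}.$$ Then, up to a Lebesgue-null set, $$\Big(0,\frac M2\Big)\times(-1,1)\subseteq F,$$ and this inclusion holds at every point if $F$ is normalized so as to contain every point $x$ for which some ball $B_r(x)$, $r>0$, satisfies $|B_r(x)\setminus F|=0$. -/

import Mathlib

open MeasureTheory

/-- The nonlocal interaction `I(A,B) = ∬_{A×B} |x-y|^{-(n+s)} dx dy` of two subsets of `ℝⁿ`,
with values in `[0,∞]`. -/
noncomputable def setInteraction {n : ℕ} (s : ℝ) (A B : Set (EuclideanSpace ℝ (Fin n))) :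
    ENNReal :=
  ∫⁻ x in A, ∫⁻ y in B, ENNReal.ofReal (1 / ‖x - y‖ ^ ((n : ℝ) + s))

/-- The `s`-perimeter of `E` in `Ω`. -/
noncomputable def sPerimeter {n : ℕ} (s : ℝ) (E Ω : Set (EuclideanSpace ℝ (Fin n))) : ENNReal :=
  setInteraction s (E ∩ Ω) (Eᶜ ∩ Ω) + setInteraction s (E ∩ Ω) (Eᶜ ∩ Ωᶜ)
    + setInteraction s (E ∩ Ωᶜ) (Eᶜ ∩ Ω)

/-- `E` is `s`-minimal in the bounded Lipschitz set `Ω`: `E` is (Lebesgue) measurable, and its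
`s`-perimeter in `Ω` is at most that of every measurable set which agrees with `E` outside `Ω`. -/
def IsSMinimal {n : ℕ} (s : ℝ) (E Ω : Set (EuclideanSpace ℝ (Fin n))) : Prop :=
  NullMeasurableSet E volume ∧
    ∀ G : Set (EuclideanSpace ℝ (Fin n)), NullMeasurableSet G volume → G \ Ω = E \ Ω →
      sPerimeter s E Ω ≤ sPerimeter s G Ω

/-- The open rectangle `(a,b) × (c,d)` in the plane. -/
def openRect (a b c d : ℝ) : Set (EuclideanSpace ℝ (Fin 2)) :=
  {x | x 0 ∈ Set.Ioo a b ∧ x 1 ∈ Set.Ioo c d}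

/-- The vertical strip `{a < x₁ < b}` in the plane. -/
def vertStrip (a b : ℝ) : Set (EuclideanSpace ℝ (Fin 2)) :=
  {x | x 0 ∈ Set.Ioo a b}

/-- The measure theoretic interior of `F`: the points that have a ball around them which is
contained in `F` up to a Lebesgue-null set. -/
def measureInterior (F : Set (EuclideanSpace ℝ (Fin 2))) : Set (EuclideanSpace ℝ (Fin 2)) :=
  {x | ∃ r : ℝ, 0 < r ∧ volume (Metric.ball x r \ F) = 0}

/-! A calibration argument. Slide the graph of a small bump `barrier μ`, which vanishes on `[-1,1]`
and reaches height `μ` at `±2`, horizontally: the translates are the level sets of `t(x) = x 0 -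
barrier μ (x 1)`. Let `A` be the part of the rectangle outside `F` with `t > 0` (`barrierGap`). Over
`|x 1| < 1` this is everything `F` misses, so it suffices that `A` is null.

Fix `x` in `A` and let `S` be `F` together with the points of `A` to the right of the leaf through
`x`. The kernel centred at `x` has more mass on `S` than on its complement, by a fixed `c > 0`
(`setLIntegral_gap_balance`). Indeed, pair `x - z` with `x + z`. If both miss `S`, then `z` is far
away or lies in a set of horizontal width at most `2 * μ * w ^ 2` at height `w`, which costs little
because `s < 1`. Both are in `S` for all `z` in a fixed square-like region, because `F` contains the
lower left quadrant near the origin as well as the region right of the leaf.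

Integrating over `A`, the interactions of `A` with itself cancel by symmetry
(`kernelInteraction_add_le_of_foliation`), so `I(A, Fᶜ \ A) + c|A| ≤ I(A, F)`. Minimality tested
against adding `A` gives the finite bound `I(A, F) ≤ I(A, Fᶜ \ A)` (`IsSMinimal.setInteraction_le`),
hence `|A| = 0`. The cancellation needs finite integrals, so it is done for truncated kernels and
passed to the limit. -/

/-- The kernel `|z|^{-(n+s)}` of the `s`-perimeter. -/
noncomputable def fracKernel {n : ℕ} (s : ℝ) (z : EuclideanSpace ℝ (Fin n)) : ENNReal :=
  ENNReal.ofReal (1 / ‖z‖ ^ ((n : ℝ) + s))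

/-- The interaction of two sets with respect to a convolution kernel. -/
noncomputable def kernelInteraction {n : ℕ} (k : EuclideanSpace ℝ (Fin n) → ENNReal)
    (A B : Set (EuclideanSpace ℝ (Fin n))) : ENNReal :=
  ∫⁻ x in A, ∫⁻ y in B, k (x - y)

/-! ### Interactions, minimality and the calibration inequality -/

section Interaction

variable {n : ℕ} {k : EuclideanSpace ℝ (Fin n) → ENNReal}
  {A B C : Set (EuclideanSpace ℝ (Fin n))}

theorem setInteraction_eq_kernelInteraction (s : ℝ) (A B : Set (EuclideanSpace ℝ (Fin n))) :
    setInteraction s A B = kernelInteraction (fracKernel s) A B := rfl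

theorem measurable_fracKernel (s : ℝ) :
    Measurable (fracKernel s : EuclideanSpace ℝ (Fin n) → ENNReal) := by
  unfold fracKernel
  fun_prop

theorem fracKernel_neg (s : ℝ) (z : EuclideanSpace ℝ (Fin n)) :
    fracKernel s (-z) = fracKernel s z := by
  simp [fracKernel]

theorem measurable_setLIntegral_sub (hk : Measurable k) (B : Set (EuclideanSpace ℝ (Fin n))) :
    Measurable fun x => ∫⁻ y in B, k (x - y) :=
  Measurable.lintegral_prod_right' (f := fun p : _ × _ => k (p.1 - p.2)) (by fun_prop)

theorem kernelInteraction_union_left (hB : MeasurableSet B) (h : Disjoint A B) :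
    kernelInteraction k (A ∪ B) C = kernelInteraction k A C + kernelInteraction k B C :=
  lintegral_union hB h

theorem kernelInteraction_union_right (hk : Measurable k) (hC : MeasurableSet C)
    (h : Disjoint B C) :
    kernelInteraction k A (B ∪ C) = kernelInteraction k A B + kernelInteraction k A C := by
  unfold kernelInteraction
  rw [← lintegral_add_left (measurable_setLIntegral_sub hk B)]
  exact lintegral_congr fun x => lintegral_union hC h

theorem kernelInteraction_comm (hk : Measurable k) (hneg : ∀ z, k (-z) = k z)
    (A B : Set (EuclideanSpace ℝ (Fin n))) :
    kernelInteraction k A B = kernelInteraction k B A := by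
  unfold kernelInteraction
  rw [lintegral_lintegral_swap (by fun_prop)]
  refine lintegral_congr fun x => lintegral_congr fun y => ?_
  rw [← hneg, neg_sub]

theorem kernelInteraction_mono {A' B' : Set (EuclideanSpace ℝ (Fin n))} (hA : A ⊆ A')
    (hB : B ⊆ B') : kernelInteraction k A B ≤ kernelInteraction k A' B' :=
  (lintegral_mono_set hA).trans (lintegral_mono fun _ => lintegral_mono_set hB)

theorem kernelInteraction_mono_kernel {k' : EuclideanSpace ℝ (Fin n) → ENNReal}
    (h : ∀ z, k z ≤ k' z) : kernelInteraction k A B ≤ kernelInteraction k' A B :=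
  lintegral_mono fun _ => lintegral_mono fun _ => h _

theorem kernelInteraction_congr_ae {A' B' : Set (EuclideanSpace ℝ (Fin n))}
    (hA : A =ᵐ[volume] A') (hB : B =ᵐ[volume] B') :
    kernelInteraction k A B = kernelInteraction k A' B' := by
  unfold kernelInteraction
  rw [Measure.restrict_congr_set hA, Measure.restrict_congr_set hB]

theorem sPerimeter_congr_ae (s : ℝ) {E E' : Set (EuclideanSpace ℝ (Fin n))}
    (Ω : Set (EuclideanSpace ℝ (Fin n))) (h : E =ᵐ[volume] E') :
    sPerimeter s E Ω = sPerimeter s E' Ω := by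
  have hr : ∀ S : Set (EuclideanSpace ℝ (Fin n)), S =ᵐ[volume] S := fun S => ae_eq_refl _
  simp only [sPerimeter, setInteraction_eq_kernelInteraction]
  rw [kernelInteraction_congr_ae (ae_eq_set_inter h (hr Ω)) (ae_eq_set_inter h.compl (hr Ω)),
    kernelInteraction_congr_ae (ae_eq_set_inter h (hr Ω)) (ae_eq_set_inter h.compl (hr Ωᶜ)),
    kernelInteraction_congr_ae (ae_eq_set_inter h (hr Ωᶜ)) (ae_eq_set_inter h.compl (hr Ω))]

/-- The part of the `s`-perimeter that does not change when `A` is added to `F`. -/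
theorem exists_sPerimeter_eq_add (s : ℝ) {F Ω : Set (EuclideanSpace ℝ (Fin n))}
    (hF : MeasurableSet F) (hΩ : MeasurableSet Ω) (hA : MeasurableSet A) (hAΩ : A ⊆ Ω)
    (hAF : Disjoint A F) :
    ∃ X, sPerimeter s F Ω = X + setInteraction s A F ∧
      sPerimeter s (F ∪ A) Ω = X + setInteraction s A (Fᶜ \ A) := by
  have hk := measurable_fracKernel (n := n) s
  set k : EuclideanSpace ℝ (Fin n) → ENNReal := fracKernel s with hkdef
  set H := Fᶜ \ A with hH
  have hHm : MeasurableSet H := hF.compl.diff hA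
  -- Since `A ⊆ Ω`, every pair with one point in `A` is counted in full; the remaining pairs join
  -- `F` to `H`, with or without `A`.
  refine ⟨kernelInteraction k (F ∩ Ω) (H ∩ Ω) + kernelInteraction k (F ∩ Ω) (H ∩ Ωᶜ)
    + kernelInteraction k (F ∩ Ωᶜ) (H ∩ Ω), ?_, ?_⟩
  · have e1 : Fᶜ ∩ Ω = (H ∩ Ω) ∪ A := by
      ext x
      have := @hAΩ x
      have hd : x ∈ A → x ∉ F := fun h => Set.disjoint_left.1 hAF h
      simp only [hH, Set.mem_inter_iff, Set.mem_compl_iff, Set.mem_union, Set.mem_sdiff]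
      tauto
    have e2 : Fᶜ ∩ Ωᶜ = H ∩ Ωᶜ := by
      ext x
      have := @hAΩ x
      simp only [hH, Set.mem_inter_iff, Set.mem_compl_iff, Set.mem_sdiff]
      tauto
    have d1 : Disjoint (H ∩ Ω) A := Set.disjoint_left.2 fun x hx => hx.1.2
    have e3 : setInteraction s A F
        = kernelInteraction k (F ∩ Ω) A + kernelInteraction k (F ∩ Ωᶜ) A := by
      rw [setInteraction_eq_kernelInteraction, ← hkdef,
        kernelInteraction_comm hk (fracKernel_neg s), ← kernelInteraction_union_left
        (hF.inter hΩ.compl), Set.inter_union_compl]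
      exact Set.disjoint_left.2 fun x hx hx' => hx'.2 hx.2
    simp only [sPerimeter, setInteraction_eq_kernelInteraction, ← hkdef] at e3 ⊢
    rw [e1, e2, e3, kernelInteraction_union_right hk hA d1,
      kernelInteraction_union_right hk hA d1]
    ring
  · have e0 : (F ∪ A)ᶜ = H := by
      ext x
      simp only [hH, Set.mem_compl_iff, Set.mem_union, Set.mem_sdiff]
      tauto
    have e1 : (F ∪ A) ∩ Ω = (F ∩ Ω) ∪ A := by
      ext x
      have := @hAΩ x
      simp only [Set.mem_inter_iff, Set.mem_union]
      tauto
    have e2 : (F ∪ A) ∩ Ωᶜ = F ∩ Ωᶜ := by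
      ext x
      have := @hAΩ x
      simp only [Set.mem_inter_iff, Set.mem_union, Set.mem_compl_iff]
      tauto
    have d1 : Disjoint (F ∩ Ω) A := hAF.symm.mono_left Set.inter_subset_left
    have e3 : setInteraction s A H
        = kernelInteraction k A (H ∩ Ω) + kernelInteraction k A (H ∩ Ωᶜ) := by
      rw [setInteraction_eq_kernelInteraction, ← hkdef, ← kernelInteraction_union_right hk
        (hHm.inter hΩ.compl), Set.inter_union_compl]
      exact Set.disjoint_left.2 fun x hx hx' => hx'.2 hx.2
    simp only [sPerimeter, setInteraction_eq_kernelInteraction, ← hkdef] at e3 ⊢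
    rw [e0, e1, e2, e3, kernelInteraction_union_left hA d1, kernelInteraction_union_left hA d1]
    ring

theorem IsSMinimal.sPerimeter_le_union {s : ℝ} {E F Ω : Set (EuclideanSpace ℝ (Fin n))}
    (hE : IsSMinimal s E Ω) (hEF : E =ᵐ[volume] F) (hA : MeasurableSet A) (hAΩ : A ⊆ Ω) :
    sPerimeter s F Ω ≤ sPerimeter s (F ∪ A) Ω := by
  -- A competitor must equal `E` exactly outside `Ω`, so the test set is `E ∪ A`, not `F ∪ A`.
  rw [← sPerimeter_congr_ae s Ω hEF,
    ← sPerimeter_congr_ae s Ω (ae_eq_set_union hEF (ae_eq_refl A))]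
  refine hE.2 _ (hE.1.union hA.nullMeasurableSet) ?_
  rw [Set.union_sdiff_distrib, Set.sdiff_eq_empty.2 hAΩ, Set.union_empty]

/-- The competitor is `E \ Ω`. With the right side finite, common terms can be cancelled in the
minimality inequality. -/
theorem IsSMinimal.sPerimeter_le_interaction_compl {s : ℝ}
    {E Ω : Set (EuclideanSpace ℝ (Fin n))} (hE : IsSMinimal s E Ω) (hΩ : MeasurableSet Ω) :
    sPerimeter s E Ω ≤ setInteraction s Ω Ωᶜ := by
  refine (hE.2 (E \ Ω) (hE.1.diff hΩ.nullMeasurableSet) (by simp)).trans ?_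
  have e : (E \ Ω) ∩ Ω = ∅ := Set.sdiff_inter_self
  simp only [sPerimeter, setInteraction_eq_kernelInteraction, e]
  rw [kernelInteraction_comm (measurable_fracKernel s) (fracKernel_neg s) Ω]
  simp only [kernelInteraction, Measure.restrict_empty, lintegral_zero_measure, zero_add]
  exact kernelInteraction_mono Set.inter_subset_right Set.inter_subset_right

/-- Adding `A` to an `s`-minimal set does not decrease the nonlocal energy. -/
theorem IsSMinimal.setInteraction_le {s : ℝ} {E F Ω : Set (EuclideanSpace ℝ (Fin n))}
    (hE : IsSMinimal s E Ω) (hEF : E =ᵐ[volume] F) (hF : MeasurableSet F)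
    (hΩ : MeasurableSet Ω) (hfin : setInteraction s Ω Ωᶜ ≠ ⊤) (hA : MeasurableSet A)
    (hAΩ : A ⊆ Ω) (hAF : Disjoint A F) :
    setInteraction s A F ≠ ⊤ ∧ setInteraction s A F ≤ setInteraction s A (Fᶜ \ A) := by
  obtain ⟨X, h1, h2⟩ := exists_sPerimeter_eq_add s hF hΩ hA hAΩ hAF
  have h3 := hE.sPerimeter_le_union hEF hA hAΩ
  have h4 : sPerimeter s F Ω ≠ ⊤ := by
    rw [← sPerimeter_congr_ae s Ω hEF]
    exact ne_top_of_le_ne_top hfin (hE.sPerimeter_le_interaction_compl hΩ)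
  rw [h1] at h4
  rw [h1, h2] at h3
  obtain ⟨hX, hI⟩ := ENNReal.add_ne_top.1 h4
  exact ⟨hI, (ENNReal.add_le_add_iff_left hX).1 h3⟩

/-- The interaction of a set with the two sides of a foliation, for an integrable even kernel. -/
theorem kernelInteraction_add_le_of_foliation (hk : Measurable k) (hneg : ∀ z, k (-z) = k z)
    (hkfin : ∫⁻ z, k z ≠ ⊤) {F : Set (EuclideanSpace ℝ (Fin n))}
    (hA : MeasurableSet A) (hAF : Disjoint A F) (hAfin : volume A ≠ ⊤)
    {t : EuclideanSpace ℝ (Fin n) → ℝ} (ht : Measurable t) (c : ENNReal)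
    (h : ∀ x ∈ A, (∫⁻ y in (F ∪ (A ∩ {y | t x < t y}))ᶜ, k (x - y)) + c
      ≤ ∫⁻ y in F ∪ (A ∩ {y | t x < t y}), k (x - y)) :
    kernelInteraction k A (Fᶜ \ A) + c * volume A ≤ kernelInteraction k A F := by
  set up : EuclideanSpace ℝ (Fin n) → ENNReal := fun x => ∫⁻ y in A ∩ {y | t x < t y}, k (x - y)
  set dn : EuclideanSpace ℝ (Fin n) → ENNReal := fun x => ∫⁻ y in A ∩ {y | t y < t x}, k (x - y)
  have hupm : ∀ x, MeasurableSet {y | t x < t y} := fun x => measurableSet_lt measurable_const ht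
  have hdnm : ∀ x, MeasurableSet {y | t y < t x} := fun x => measurableSet_lt ht measurable_const
  have eup : ∀ x, up x = ∫⁻ y in A, {p : EuclideanSpace ℝ (Fin n) × EuclideanSpace ℝ (Fin n) |
      t p.1 < t p.2}.indicator (fun p => k (p.1 - p.2)) (x, y) := by
    intro x
    have : ∀ y, {p : EuclideanSpace ℝ (Fin n) × EuclideanSpace ℝ (Fin n) |
      t p.1 < t p.2}.indicator (fun p => k (p.1 - p.2)) (x, y)
      = {y | t x < t y}.indicator (fun y => k (x - y)) y := fun y => rfl
    simp only [this]
    rw [setLIntegral_indicator (hupm x), Set.inter_comm]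
  have edn : ∀ x, dn x = ∫⁻ y in A, {p : EuclideanSpace ℝ (Fin n) × EuclideanSpace ℝ (Fin n) |
      t p.2 < t p.1}.indicator (fun p => k (p.1 - p.2)) (x, y) := by
    intro x
    have : ∀ y, {p : EuclideanSpace ℝ (Fin n) × EuclideanSpace ℝ (Fin n) |
      t p.2 < t p.1}.indicator (fun p => k (p.1 - p.2)) (x, y)
      = {y | t y < t x}.indicator (fun y => k (x - y)) y := fun y => rfl
    simp only [this]
    rw [setLIntegral_indicator (hdnm x), Set.inter_comm]
  have mup : Measurable (({p : EuclideanSpace ℝ (Fin n) × EuclideanSpace ℝ (Fin n) |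
      t p.1 < t p.2}).indicator (fun p => k (p.1 - p.2))) :=
    Measurable.indicator (by fun_prop)
      (measurableSet_lt (ht.comp measurable_fst) (ht.comp measurable_snd))
  -- Exchanging `x` and `y` turns `up` into `dn`, as the kernel is even.
  have hsymm : ∫⁻ x in A, up x = ∫⁻ x in A, dn x := by
    simp only [eup, edn]
    rw [lintegral_lintegral_swap (f := fun x y => {p : EuclideanSpace ℝ (Fin n) ×
      EuclideanSpace ℝ (Fin n) | t p.1 < t p.2}.indicator (fun p => k (p.1 - p.2)) (x, y))
      mup.aemeasurable]
    refine lintegral_congr fun x => lintegral_congr fun y => ?_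
    simp only [Set.indicator, Set.mem_ofPred_eq]
    rw [← hneg, neg_sub]
  have hfin : ∫⁻ x in A, up x ≠ ⊤ := by
    have hle : ∀ x, up x ≤ ∫⁻ z, k z := fun x => by
      calc up x ≤ ∫⁻ y, k (x - y) := setLIntegral_le_lintegral _ _
        _ = ∫⁻ z, k z := lintegral_sub_left_eq_self k x
    refine ne_top_of_le_ne_top ?_ (lintegral_mono hle)
    rw [setLIntegral_const]
    exact ENNReal.mul_ne_top hkfin hAfin
  -- Points of `A` on the leaf of `x` itself lie in the complement and are dropped, which is
  -- harmless in this direction.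
  have key : ∀ x ∈ A, (∫⁻ y in Fᶜ \ A, k (x - y)) + c + dn x
      ≤ (∫⁻ y in F, k (x - y)) + up x := by
    intro x hx
    have e1 : ∫⁻ y in F ∪ (A ∩ {y | t x < t y}), k (x - y) = (∫⁻ y in F, k (x - y)) + up x :=
      lintegral_union (hA.inter (hupm x)) (hAF.symm.mono_right Set.inter_subset_left)
    have e2 : (∫⁻ y in Fᶜ \ A, k (x - y)) + dn x
        ≤ ∫⁻ y in (F ∪ (A ∩ {y | t x < t y}))ᶜ, k (x - y) := by
      rw [← lintegral_union (hA.inter (hdnm x))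
        (Set.disjoint_left.2 fun y hy hy' => hy.2 hy'.1)]
      refine lintegral_mono_set ?_
      rintro y (hy | hy) (hy' | hy')
      · exact hy.1 hy'
      · exact hy.2 hy'.1
      · exact Set.disjoint_left.1 hAF hy.1 hy'
      · exact lt_asymm (a := t y) hy.2 hy'.2
    rw [← e1, add_right_comm]
    exact (add_le_add_left e2 c).trans (h x hx)
  have hsum := setLIntegral_mono' (μ := volume) hA key
  rw [lintegral_add_left ((measurable_setLIntegral_sub hk _).add_const c),
    lintegral_add_left (measurable_setLIntegral_sub hk _),
    lintegral_add_left (measurable_setLIntegral_sub hk _), setLIntegral_const, ← hsymm] at hsum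
  exact (ENNReal.add_le_add_iff_right hfin).1 hsum

/-- An even kernel integrates to more over `W` than over `Wᶜ` if it integrates to more over the
points that lie in `W` together with their antipodes than over those for which neither does. -/
theorem setLIntegral_compl_add_le_of_even {W Q N : Set (EuclideanSpace ℝ (Fin n))}
    (hneg : ∀ z, k (-z) = k z) (hW : MeasurableSet W) (c : ENNReal)
    (hQ : ∀ z ∈ Q, z ∈ W ∧ -z ∈ W) (hN : ∀ z, z ∉ W → -z ∉ W → z ∈ N)
    (h : (∫⁻ z in N, k z) + c ≤ ∫⁻ z in Q, k z) :
    (∫⁻ z in Wᶜ, k z) + c ≤ ∫⁻ z in W, k z := by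
  have hV : MeasurableSet (Neg.neg ⁻¹' W) := measurable_neg hW
  -- Antipodal pairs with exactly one point in `W` contribute equally to both sides.
  have e : ∫⁻ z in Wᶜ ∩ Neg.neg ⁻¹' W, k z = ∫⁻ z in W \ Neg.neg ⁻¹' W, k z := by
    rw [← lintegral_indicator (hW.compl.inter hV), ← lintegral_indicator (hW.diff hV),
      ← lintegral_neg_eq_self]
    refine lintegral_congr fun z => ?_
    simp only [Set.indicator, hneg]
    congr 1
    simp [and_comm]
  rw [← lintegral_inter_add_sdiff k Wᶜ hV, ← lintegral_inter_add_sdiff k W hV, e, add_assoc,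
    add_comm (∫⁻ z in W ∩ Neg.neg ⁻¹' W, k z)]
  gcongr
  calc _ ≤ (∫⁻ z in N, k z) + c := by
        gcongr
        rintro z ⟨h1, h2⟩
        exact hN z h1 h2
    _ ≤ ∫⁻ z in Q, k z := h
    _ ≤ _ := lintegral_mono_set fun z hz => hQ z hz

end Interaction

/-! ### Tails of the fractional kernel -/

section FracKernel

variable {n : ℕ} {s : ℝ}

theorem lintegral_fracKernel_one_le_norm_lt_top (hs : 0 < s) :
    ∫⁻ z in {z : EuclideanSpace ℝ (Fin n) | 1 ≤ ‖z‖}, fracKernel s z < ⊤ := by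
  have hr : (Module.finrank ℝ (EuclideanSpace ℝ (Fin n)) : ℝ) < n + s := by simpa using hs
  have hfin := finite_integral_one_add_norm
    (μ := (volume : Measure (EuclideanSpace ℝ (Fin n)))) hr
  have hle : ∫⁻ z in {z : EuclideanSpace ℝ (Fin n) | 1 ≤ ‖z‖}, fracKernel s z
      ≤ ∫⁻ z : EuclideanSpace ℝ (Fin n), ENNReal.ofReal (2 ^ ((n : ℝ) + s))
        * ENNReal.ofReal ((1 + ‖z‖) ^ (-((n : ℝ) + s))) := by
    refine le_trans (setLIntegral_mono' (measurableSet_le measurable_const measurable_norm) ?_)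
      (setLIntegral_le_lintegral {z : EuclideanSpace ℝ (Fin n) | 1 ≤ ‖z‖} _)
    intro z hz
    have hz1 : 1 ≤ ‖z‖ := hz
    have hns : 0 ≤ (n : ℝ) + s := by positivity
    rw [fracKernel, ← ENNReal.ofReal_mul (by positivity)]
    refine ENNReal.ofReal_le_ofReal ?_
    rw [Real.rpow_neg (by positivity), ← div_eq_mul_inv,
      div_le_div_iff₀ (by positivity) (by positivity), one_mul,
      ← Real.mul_rpow (by positivity) (by positivity)]
    exact Real.rpow_le_rpow (by positivity) (by linarith) hns
  refine hle.trans_lt ?_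
  rw [lintegral_const_mul _ (by fun_prop)]
  exact ENNReal.mul_lt_top ENNReal.ofReal_lt_top hfin

/-- Scaling: the kernel is homogeneous of degree `-(n+s)` and Lebesgue measure contributes `r ^ n`.
-/
theorem lintegral_fracKernel_le_norm {r : ℝ} (hr : 0 < r) :
    ∫⁻ z in {z : EuclideanSpace ℝ (Fin n) | r ≤ ‖z‖}, fracKernel s z
      = ENNReal.ofReal (r ^ (-s)) *
        ∫⁻ z in {z : EuclideanSpace ℝ (Fin n) | 1 ≤ ‖z‖}, fracKernel s z := by
  have hm : ∀ ρ : ℝ, MeasurableSet {z : EuclideanSpace ℝ (Fin n) | ρ ≤ ‖z‖} := fun ρ =>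
    measurableSet_le measurable_const measurable_norm
  set f : EuclideanSpace ℝ (Fin n) → ENNReal :=
    {z : EuclideanSpace ℝ (Fin n) | 1 ≤ ‖z‖}.indicator (fracKernel s) with hf
  have hfm : Measurable f := (measurable_fracKernel s).indicator (hm 1)
  have hscale : ∀ z, {z : EuclideanSpace ℝ (Fin n) | r ≤ ‖z‖}.indicator (fracKernel s) z
      = ENNReal.ofReal (r ^ (-((n : ℝ) + s))) * f (r⁻¹ • z) := by
    intro z
    have hnorm : ‖r⁻¹ • z‖ = r⁻¹ * ‖z‖ := by rw [norm_smul, Real.norm_of_nonneg (by positivity)]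
    have hiff : 1 ≤ r⁻¹ * ‖z‖ ↔ r ≤ ‖z‖ := by
      rw [inv_mul_eq_div, le_div_iff₀ hr, one_mul]
    by_cases hz : r ≤ ‖z‖
    · rw [Set.indicator_of_mem (by exact hz), hf, Set.indicator_of_mem (by
        change 1 ≤ ‖r⁻¹ • z‖
        rw [hnorm, hiff]
        exact hz), fracKernel, fracKernel, ← ENNReal.ofReal_mul (by positivity), hnorm,
        Real.mul_rpow (by positivity) (by positivity), Real.inv_rpow hr.le, Real.rpow_neg hr.le]
      congr 1
      have : r ^ ((n : ℝ) + s) ≠ 0 := (Real.rpow_pos_of_pos hr _).ne'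
      field_simp
    · rw [Set.indicator_of_notMem (by exact hz), hf, Set.indicator_of_notMem, mul_zero]
      change ¬ 1 ≤ ‖r⁻¹ • z‖
      rw [hnorm, hiff]
      exact hz
  have hmap : ∫⁻ z, f (r⁻¹ • z) = ENNReal.ofReal (r ^ n) * ∫⁻ z, f z := by
    rw [← lintegral_map hfm (measurable_const_smul r⁻¹),
      Measure.map_addHaar_smul _ (inv_ne_zero hr.ne'), lintegral_smul_measure]
    simp [abs_of_pos hr]
  rw [← lintegral_indicator (hm r), ← lintegral_indicator (hm 1), ← hf]
  simp only [hscale]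
  rw [lintegral_const_mul _ (by fun_prop), hmap, ← mul_assoc,
    ← ENNReal.ofReal_mul (by positivity)]
  congr 2
  rw [← Real.rpow_natCast, ← Real.rpow_add hr]
  congr 1
  ring

theorem setLIntegral_fracKernel_sub_le {r : ℝ} (hr : 0 < r) (x : EuclideanSpace ℝ (Fin n))
    {S : Set (EuclideanSpace ℝ (Fin n))} (hS : ∀ y ∈ S, r ≤ ‖x - y‖) :
    ∫⁻ y in S, fracKernel s (x - y) ≤ ENNReal.ofReal (r ^ (-s)) *
        ∫⁻ z in {z : EuclideanSpace ℝ (Fin n) | 1 ≤ ‖z‖}, fracKernel s z := by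
  have hm : MeasurableSet {z : EuclideanSpace ℝ (Fin n) | r ≤ ‖z‖} :=
    measurableSet_le measurable_const measurable_norm
  rw [← lintegral_fracKernel_le_norm hr]
  calc ∫⁻ y in S, fracKernel s (x - y)
      ≤ ∫⁻ y in {y | r ≤ ‖x - y‖}, fracKernel s (x - y) := lintegral_mono_set hS
    _ = ∫⁻ y, {z : EuclideanSpace ℝ (Fin n) | r ≤ ‖z‖}.indicator (fracKernel s) (x - y) := by
        rw [← lintegral_indicator (measurableSet_le measurable_const (by fun_prop))]
        rfl
    _ = ∫⁻ z, {z : EuclideanSpace ℝ (Fin n) | r ≤ ‖z‖}.indicator (fracKernel s) z :=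
        lintegral_sub_left_eq_self _ x
    _ = _ := lintegral_indicator hm _

end FracKernel

/-! ### Planar integrals: rectangles and thin sets -/

section Plane

theorem lintegral_euclideanPlane {f : ℝ × ℝ → ENNReal} (hf : Measurable f) :
    ∫⁻ z : EuclideanSpace ℝ (Fin 2), f (z 0, z 1) = ∫⁻ w, ∫⁻ u, f (u, w) := by
  have h1 := (volume_preserving_finTwoArrow ℝ).comp (PiLp.volume_preserving_ofLp (Fin 2))
  have h2 := h1.lintegral_comp hf
  rw [Measure.volume_eq_prod, lintegral_prod_symm _ hf.aemeasurable] at h2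
  exact h2

theorem measurableSet_openRect (a b c d : ℝ) : MeasurableSet (openRect a b c d) := by
  have h0 : Measurable fun x : EuclideanSpace ℝ (Fin 2) => x 0 := by fun_prop
  have h1 : Measurable fun x : EuclideanSpace ℝ (Fin 2) => x 1 := by fun_prop
  exact (h0 measurableSet_Ioo).inter (h1 measurableSet_Ioo)

theorem isOpen_openRect (a b c d : ℝ) : IsOpen (openRect a b c d) := by
  have h0 : Continuous fun x : EuclideanSpace ℝ (Fin 2) => x 0 := by fun_prop
  have h1 : Continuous fun x : EuclideanSpace ℝ (Fin 2) => x 1 := by fun_prop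
  exact (isOpen_Ioo.preimage h0).inter (isOpen_Ioo.preimage h1)

theorem setLIntegral_openRect {f g : ℝ → ENNReal} (hf : Measurable f) (hg : Measurable g)
    (a b c d : ℝ) :
    ∫⁻ x in openRect a b c d, f (x 0) * g (x 1)
      = (∫⁻ u in Set.Ioo a b, f u) * ∫⁻ w in Set.Ioo c d, g w := by
  have hF : Measurable fun p : ℝ × ℝ =>
      (Set.Ioo a b).indicator f p.1 * (Set.Ioo c d).indicator g p.2 :=
    ((hf.indicator measurableSet_Ioo).comp measurable_fst).mul
      ((hg.indicator measurableSet_Ioo).comp measurable_snd)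
  rw [← lintegral_indicator (measurableSet_openRect a b c d)]
  have e : ∀ x : EuclideanSpace ℝ (Fin 2),
      (openRect a b c d).indicator (fun x => f (x 0) * g (x 1)) x
      = (Set.Ioo a b).indicator f (x 0) * (Set.Ioo c d).indicator g (x 1) := by
    intro x
    by_cases h0 : x 0 ∈ Set.Ioo a b <;> by_cases h1 : x 1 ∈ Set.Ioo c d <;>
      simp [openRect, Set.indicator, h0, h1, -Set.mem_Ioo]
  simp only [e]
  rw [lintegral_euclideanPlane hF]
  simp only [lintegral_mul_const _ (hf.indicator measurableSet_Ioo)]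
  rw [lintegral_const_mul _ (hg.indicator measurableSet_Ioo),
    lintegral_indicator measurableSet_Ioo, lintegral_indicator measurableSet_Ioo]

theorem setLIntegral_Ioo_sub_rpow_lt_top {s : ℝ} (hs : s < 1) (a b : ℝ) :
    ∫⁻ u in Set.Ioo a b, ENNReal.ofReal ((u - a) ^ (-s)) < ⊤ := by
  rcases le_or_gt b a with hab | hab
  · simp [Set.Ioo_eq_empty (not_lt.2 hab)]
  have h1 : IntervalIntegrable (fun u : ℝ => u ^ (-s)) volume 0 (b - a) :=
    intervalIntegral.intervalIntegrable_rpow' (by linarith)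
  have h2 := h1.comp_sub_right a
  simp only [zero_add, sub_add_cancel] at h2
  rw [intervalIntegrable_iff_integrableOn_Ioo_of_le hab.le] at h2
  exact h2.lintegral_lt_top

theorem setLIntegral_Ioo_sub_rpow_lt_top' {s : ℝ} (hs : s < 1) (a b : ℝ) :
    ∫⁻ u in Set.Ioo a b, ENNReal.ofReal ((b - u) ^ (-s)) < ⊤ := by
  rcases le_or_gt b a with hab | hab
  · simp [Set.Ioo_eq_empty (not_lt.2 hab)]
  have h1 : IntervalIntegrable (fun u : ℝ => u ^ (-s)) volume (b - a) 0 :=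
    intervalIntegral.intervalIntegrable_rpow' (by linarith)
  have h2 := h1.comp_sub_left b
  simp only [sub_sub_cancel, sub_zero] at h2
  rw [intervalIntegrable_iff_integrableOn_Ioo_of_le hab.le] at h2
  exact h2.lintegral_lt_top

theorem setLIntegral_Ioo_abs_rpow_lt_top {s : ℝ} (hs : s < 1) (R : ℝ) :
    ∫⁻ w in Set.Ioo (-R) R, ENNReal.ofReal (|w| ^ (-s)) < ⊤ := by
  have h1 : ∫⁻ w in Set.Ioo 0 R, ENNReal.ofReal (|w| ^ (-s)) < ⊤ := by
    refine lt_of_eq_of_lt ?_ (setLIntegral_Ioo_sub_rpow_lt_top hs 0 R)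
    refine setLIntegral_congr_fun measurableSet_Ioo fun w hw => ?_
    simp only [sub_zero, abs_of_pos hw.1]
  have h2 : ∫⁻ w in Set.Ioo (-R) 0, ENNReal.ofReal (|w| ^ (-s)) < ⊤ := by
    refine lt_of_eq_of_lt ?_ (setLIntegral_Ioo_sub_rpow_lt_top' hs (-R) 0)
    refine setLIntegral_congr_fun measurableSet_Ioo fun w hw => ?_
    simp only [zero_sub, abs_of_neg hw.2]
  have hsub : Set.Ioo (-R) R ⊆ (Set.Ioo 0 R ∪ Set.Ioo (-R) 0) ∪ {0} := by
    intro w hw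
    rcases lt_trichotomy w 0 with h | h | h
    · exact Or.inl (Or.inr ⟨hw.1, h⟩)
    · exact Or.inr h
    · exact Or.inl (Or.inl ⟨h, hw.2⟩)
  refine (lintegral_mono_set hsub).trans_lt ?_
  refine (lintegral_union_le _ _ _).trans_lt (ENNReal.add_lt_top.2 ⟨?_, by simp⟩)
  exact (lintegral_union_le _ _ _).trans_lt (ENNReal.add_lt_top.2 ⟨h1, h2⟩)

/-- The interaction of a rectangle with its complement is finite. -/
theorem setInteraction_openRect_compl_ne_top {s : ℝ} (hs0 : 0 < s) (hs1 : s < 1)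
    (a b c d : ℝ) : setInteraction s (openRect a b c d) (openRect a b c d)ᶜ ≠ ⊤ := by
  set T := ∫⁻ z in {z : EuclideanSpace ℝ (Fin 2) | 1 ≤ ‖z‖}, fracKernel s z
  have hT : T < ⊤ := lintegral_fracKernel_one_le_norm_lt_top hs0
  have hcoord : ∀ (z : EuclideanSpace ℝ (Fin 2)) (i : Fin 2), |z i| ≤ ‖z‖ := fun z i =>
    PiLp.norm_apply_le z i
  -- The complement is covered by four half-planes, each costing its distance to `x` to the power
  -- `-s`, which is integrable for `s < 1`.
  have hpt : ∀ x ∈ openRect a b c d, ∫⁻ y in (openRect a b c d)ᶜ, fracKernel s (x - y)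
      ≤ (ENNReal.ofReal ((x 0 - a) ^ (-s)) * 1 + ENNReal.ofReal ((b - x 0) ^ (-s)) * 1
        + 1 * ENNReal.ofReal ((x 1 - c) ^ (-s)) + 1 * ENNReal.ofReal ((d - x 1) ^ (-s))) * T := by
    rintro x ⟨⟨hx1, hx2⟩, ⟨hx3, hx4⟩⟩
    have hsub : (openRect a b c d)ᶜ ⊆ (({y | y 0 ≤ a} ∪ {y | b ≤ y 0}) ∪ {y | y 1 ≤ c})
        ∪ {y | d ≤ y 1} := by
      intro y hy
      by_contra hcon
      simp only [Set.mem_union, Set.mem_ofPred_eq, not_or, not_le] at hcon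
      exact hy ⟨⟨hcon.1.1.1, hcon.1.1.2⟩, ⟨hcon.1.2, hcon.2⟩⟩
    have hd : ∀ (y : EuclideanSpace ℝ (Fin 2)) (i : Fin 2), |x i - y i| ≤ ‖x - y‖ := fun y i => by
      simpa using hcoord (x - y) i
    refine (lintegral_mono_set hsub).trans ?_
    simp only [mul_one, one_mul, add_mul]
    refine (lintegral_union_le _ _ _).trans (add_le_add ?_ ?_)
    · refine (lintegral_union_le _ _ _).trans (add_le_add ?_ ?_)
      · refine (lintegral_union_le _ _ _).trans (add_le_add ?_ ?_)
        · refine setLIntegral_fracKernel_sub_le (by linarith) x fun y hy => ?_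
          have hy' : y 0 ≤ a := hy
          linarith [hd y 0, le_abs_self (x 0 - y 0)]
        · refine setLIntegral_fracKernel_sub_le (by linarith) x fun y hy => ?_
          have hy' : b ≤ y 0 := hy
          linarith [hd y 0, neg_abs_le (x 0 - y 0)]
      · refine setLIntegral_fracKernel_sub_le (by linarith) x fun y hy => ?_
        have hy' : y 1 ≤ c := hy
        linarith [hd y 1, le_abs_self (x 1 - y 1)]
    · refine setLIntegral_fracKernel_sub_le (by linarith) x fun y hy => ?_
      have hy' : d ≤ y 1 := hy
      linarith [hd y 1, neg_abs_le (x 1 - y 1)]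
  have hm1 : Measurable fun u : ℝ => ENNReal.ofReal ((u - a) ^ (-s)) := by fun_prop
  have hm2 : Measurable fun u : ℝ => ENNReal.ofReal ((b - u) ^ (-s)) := by fun_prop
  have hm3 : Measurable fun u : ℝ => ENNReal.ofReal ((u - c) ^ (-s)) := by fun_prop
  have hm4 : Measurable fun u : ℝ => ENNReal.ofReal ((d - u) ^ (-s)) := by fun_prop
  have hone : Measurable fun _ : ℝ => (1 : ENNReal) := measurable_const
  have hI : ∀ p q : ℝ, ∫⁻ _ in Set.Ioo p q, (1 : ENNReal) < ⊤ := by simp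
  have hle := setLIntegral_mono' (μ := volume) (measurableSet_openRect a b c d) hpt
  refine ne_top_of_le_ne_top (ne_of_lt ?_) hle
  rw [lintegral_mul_const _ (by fun_prop), lintegral_add_left (by fun_prop),
    lintegral_add_left (by fun_prop), lintegral_add_left (by fun_prop),
    setLIntegral_openRect hm1 hone, setLIntegral_openRect hm2 hone,
    setLIntegral_openRect hone hm3, setLIntegral_openRect hone hm4]
  refine ENNReal.mul_lt_top ?_ hT
  refine ENNReal.add_lt_top.2 ⟨ENNReal.add_lt_top.2 ⟨ENNReal.add_lt_top.2 ⟨?_, ?_⟩, ?_⟩, ?_⟩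
  · exact ENNReal.mul_lt_top (setLIntegral_Ioo_sub_rpow_lt_top hs1 a b) (hI c d)
  · exact ENNReal.mul_lt_top (setLIntegral_Ioo_sub_rpow_lt_top' hs1 a b) (hI c d)
  · exact ENNReal.mul_lt_top (hI a b) (setLIntegral_Ioo_sub_rpow_lt_top hs1 c d)
  · exact ENNReal.mul_lt_top (hI a b) (setLIntegral_Ioo_sub_rpow_lt_top' hs1 c d)

/-- The power is taken in `ENNReal`, so that the bound is `⊤` on `z 1 = 0`, where a real power would
give `0`. -/
theorem fracKernel_le_coord_rpow {s : ℝ} (hs : 0 < s) (z : EuclideanSpace ℝ (Fin 2)) :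
    fracKernel s z ≤ ENNReal.ofReal |z 1| ^ (-(2 + s)) := by
  rcases eq_or_ne (z 1) 0 with h | h
  · rw [h, abs_zero, ENNReal.ofReal_zero, ENNReal.zero_rpow_of_neg (by linarith)]
    exact le_top
  · have h1 : 0 < |z 1| := abs_pos.2 h
    have h2 : |z 1| ≤ ‖z‖ := PiLp.norm_apply_le z 1
    rw [ENNReal.ofReal_rpow_of_pos h1, fracKernel]
    refine ENNReal.ofReal_le_ofReal ?_
    rw [Real.rpow_neg h1.le, one_div]
    push_cast
    exact inv_anti₀ (by positivity) (Real.rpow_le_rpow h1.le h2 (by linarith))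

/-- The kernel has small integral over a neighbourhood of the vertical axis that is quadratically
thin at the origin. -/
theorem setLIntegral_fracKernel_thin_le {s : ℝ} (hs : 0 < s) {α β : ℝ → ℝ} (hα : Measurable α)
    (hβ : Measurable β) {C : ℝ} (hC : 0 ≤ C) (R : ℝ) (h : ∀ w, β w - α w ≤ C * w ^ 2) :
    ∫⁻ z in {z : EuclideanSpace ℝ (Fin 2) | z 1 ∈ Set.Ioo (-R) R ∧ α (z 1) ≤ z 0 ∧
      z 0 ≤ β (z 1)}, fracKernel s z
      ≤ ENNReal.ofReal C * ∫⁻ w in Set.Ioo (-R) R, ENNReal.ofReal (|w| ^ (-s)) := by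
  set G : ℝ → ENNReal := fun w => ENNReal.ofReal |w| ^ (-(2 + s)) with hG
  have hGm : Measurable G := by fun_prop
  set P : Set (ℝ × ℝ) := {p | p.2 ∈ Set.Ioo (-R) R ∧ α p.2 ≤ p.1 ∧ p.1 ≤ β p.2} with hP
  have hPm : MeasurableSet P :=
    (measurable_snd measurableSet_Ioo).inter
      ((measurableSet_le (hα.comp measurable_snd) measurable_fst).inter
        (measurableSet_le measurable_fst (hβ.comp measurable_snd)))
  have hcoord : Measurable fun z : EuclideanSpace ℝ (Fin 2) => (z 0, z 1) := by fun_prop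
  have hNm : MeasurableSet {z : EuclideanSpace ℝ (Fin 2) | z 1 ∈ Set.Ioo (-R) R ∧
      α (z 1) ≤ z 0 ∧ z 0 ≤ β (z 1)} := hcoord hPm
  have hfm : Measurable (P.indicator fun p => G p.2) :=
    (hGm.comp measurable_snd).indicator hPm
  calc _ ≤ ∫⁻ z in {z : EuclideanSpace ℝ (Fin 2) | z 1 ∈ Set.Ioo (-R) R ∧ α (z 1) ≤ z 0 ∧
        z 0 ≤ β (z 1)}, G (z 1) := lintegral_mono fun z => fracKernel_le_coord_rpow hs z
    _ = ∫⁻ z : EuclideanSpace ℝ (Fin 2), (P.indicator fun p => G p.2) (z 0, z 1) := by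
        rw [← lintegral_indicator hNm]
        rfl
    _ = ∫⁻ w, ∫⁻ u, (P.indicator fun p => G p.2) (u, w) := lintegral_euclideanPlane hfm
    _ ≤ ∫⁻ w, (Set.Ioo (-R) R).indicator
          (fun w => ENNReal.ofReal C * ENNReal.ofReal (|w| ^ (-s))) w := by
        refine lintegral_mono fun w => ?_
        by_cases hw : w ∈ Set.Ioo (-R) R
        · have e : ∀ u, (P.indicator fun p => G p.2) (u, w)
              = (Set.Icc (α w) (β w)).indicator (fun _ => G w) u := by
            intro u
            simp only [Set.indicator, hP, Set.mem_ofPred_eq, hw, true_and, Set.mem_Icc]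
          simp only [e]
          rw [lintegral_indicator measurableSet_Icc, setLIntegral_const, Real.volume_Icc,
            Set.indicator_of_mem hw]
          -- At `w = 0` the bound `G` is infinite, but the slice has length zero.
          rcases eq_or_ne w 0 with h0 | h0
          · have : ENNReal.ofReal (β w - α w) = 0 :=
              ENNReal.ofReal_eq_zero.2 ((h w).trans (by simp [h0]))
            rw [this, mul_zero]
            exact zero_le
          · have h1 : 0 < |w| := abs_pos.2 h0
            calc G w * ENNReal.ofReal (β w - α w) ≤ G w * ENNReal.ofReal (C * w ^ 2) := by
                  gcongr
                  exact h w
              _ = ENNReal.ofReal C * ENNReal.ofReal (|w| ^ (-s)) := by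
                  simp only [hG]
                  rw [ENNReal.ofReal_rpow_of_pos h1, ← ENNReal.ofReal_mul (by positivity),
                    ← ENNReal.ofReal_mul hC]
                  congr 1
                  rw [mul_left_comm, ← sq_abs, ← Real.rpow_natCast, ← Real.rpow_add h1]
                  congr 2
                  push_cast
                  ring
        · have e : ∀ u, (P.indicator fun p => G p.2) (u, w) = 0 := fun u =>
            Set.indicator_of_notMem (fun hu => hw hu.1) _
          simp [e]
    _ = _ := by
        rw [lintegral_indicator measurableSet_Ioo, lintegral_const_mul _ (by fun_prop)]

end Plane

/-! ### Removing the singularity of the kernel -/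

section Truncation

variable {n : ℕ} {s : ℝ}

theorem lintegral_truncated_fracKernel_ne_top (hs : 0 < s) {ε : ℝ} (hε : 0 < ε) :
    ∫⁻ z, {z : EuclideanSpace ℝ (Fin n) | ε < ‖z‖}.indicator (fracKernel s) z ≠ ⊤ := by
  rw [lintegral_indicator (measurableSet_lt measurable_const measurable_norm)]
  have hsub : {z : EuclideanSpace ℝ (Fin n) | ε < ‖z‖} ⊆ {z | ε ≤ ‖z‖} :=
    fun z (hz : ε < ‖z‖) => hz.le
  refine ne_top_of_le_ne_top ?_ (lintegral_mono_set hsub)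
  rw [lintegral_fracKernel_le_norm hε]
  exact ENNReal.mul_ne_top ENNReal.ofReal_ne_top
    (lintegral_fracKernel_one_le_norm_lt_top hs).ne

theorem iSup_truncated_fracKernel (hs : 0 < s) (z : EuclideanSpace ℝ (Fin n)) :
    ⨆ m : ℕ, {z : EuclideanSpace ℝ (Fin n) | 1 / ((m : ℝ) + 1) < ‖z‖}.indicator (fracKernel s) z
      = fracKernel s z := by
  refine le_antisymm (iSup_le fun m => Set.indicator_le_self _ _ z) ?_
  rcases eq_or_ne z 0 with rfl | hz
  · have : fracKernel s (0 : EuclideanSpace ℝ (Fin n)) = 0 := by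
      have hne : (n : ℝ) + s ≠ 0 := by positivity
      simp [fracKernel, Real.zero_rpow hne]
    rw [this]
    exact zero_le
  · obtain ⟨m, hm⟩ := exists_nat_one_div_lt (norm_pos_iff.2 hz)
    refine le_iSup_of_le m ?_
    rw [Set.indicator_of_mem (by exact hm)]

/-- Monotone convergence; it matters that `c` and `C` do not depend on the truncation. -/
theorem setInteraction_add_le_of_truncated (hs : 0 < s)
    {A B : Set (EuclideanSpace ℝ (Fin n))} {c C : ENNReal}
    (h : ∀ m : ℕ, kernelInteraction ({z : EuclideanSpace ℝ (Fin n) |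
      1 / ((m : ℝ) + 1) < ‖z‖}.indicator (fracKernel s)) A B + c ≤ C) :
    setInteraction s A B + c ≤ C := by
  set k : ℕ → EuclideanSpace ℝ (Fin n) → ENNReal := fun m =>
    {z : EuclideanSpace ℝ (Fin n) | 1 / ((m : ℝ) + 1) < ‖z‖}.indicator (fracKernel s) with hk
  have hkm : ∀ m, Measurable (k m) := fun m =>
    (measurable_fracKernel s).indicator (measurableSet_lt measurable_const measurable_norm)
  have hmono : Monotone k := by
    intro m m' hmm
    refine Set.indicator_le_indicator_of_subset (fun z hz => ?_) (fun _ => zero_le)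
    exact (Nat.one_div_le_one_div hmm).trans_lt (show 1 / ((m : ℝ) + 1) < ‖z‖ from hz)
  have e : setInteraction s A B = ⨆ m, kernelInteraction (k m) A B := by
    rw [setInteraction_eq_kernelInteraction]
    unfold kernelInteraction
    rw [← lintegral_iSup (fun m => measurable_setLIntegral_sub (hkm m) B)
      (fun m m' hmm x => lintegral_mono fun y => hmono hmm _)]
    refine lintegral_congr fun x => ?_
    rw [← lintegral_iSup (f := fun m y => k m (x - y)) (fun m => by have := hkm m; fun_prop)
      (fun m m' hmm y => hmono hmm _)]
    exact lintegral_congr fun y => (iSup_truncated_fracKernel hs _).symm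
  rw [e, ENNReal.iSup_add]
  exact iSup_le h

end Truncation

/-! ### The barrier and its second differences -/

section Barrier

/-- The profile of the barrier: a multiple of the squared distance to `[-1,1]`. -/
noncomputable def barrier (μ y : ℝ) : ℝ := μ * max (|y| - 1) 0 ^ 2

theorem measurable_barrier (μ : ℝ) : Measurable (barrier μ) := by
  unfold barrier
  fun_prop

theorem barrier_nonneg {μ : ℝ} (hμ : 0 ≤ μ) (y : ℝ) : 0 ≤ barrier μ y := by
  unfold barrier
  positivity

theorem barrier_eq_zero (μ : ℝ) {y : ℝ} (hy : |y| ≤ 1) : barrier μ y = 0 := by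
  simp [barrier, hy]

theorem abs_lt_two_of_barrier_lt {μ : ℝ} (hμ : 0 < μ) {y : ℝ} (hy : barrier μ y < μ) :
    |y| < 2 := by
  by_contra! h
  have h1 : 1 ≤ max (|y| - 1) 0 := le_max_of_le_left (by linarith)
  have h2 : 1 ≤ max (|y| - 1) 0 ^ 2 := one_le_pow₀ h1
  unfold barrier at hy
  nlinarith

theorem barrier_le {μ : ℝ} (hμ : 0 ≤ μ) {y r : ℝ} (hr : 0 ≤ r) (hy : |y| ≤ r + 1) :
    barrier μ y ≤ μ * r ^ 2 := by
  unfold barrier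
  have h0 : 0 ≤ max (|y| - 1) 0 := le_max_right _ _
  have h1 : max (|y| - 1) 0 ≤ r := max_le (by linarith) hr
  gcongr

/-- Squared distance is an infimum of parabolas `(v - p) ^ 2` over `p` in `[-1,1]`. With `p` nearest
to `y` the parabola touches at `y` and lies above elsewhere, so its second difference `2 * w ^ 2` is
an upper bound. -/
theorem barrier_add_le {μ : ℝ} (hμ : 0 ≤ μ) (y w : ℝ) :
    barrier μ (y + w) + barrier μ (y - w) - 2 * barrier μ y ≤ 2 * μ * w ^ 2 := by
  obtain ⟨p, hp, hyp⟩ : ∃ p : ℝ, |p| ≤ 1 ∧ max (|y| - 1) 0 ^ 2 = (y - p) ^ 2 := by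
    rcases le_total |y| 1 with h | h
    · exact ⟨y, h, by simp [h]⟩
    · rcases le_total 0 y with h0 | h0
      · refine ⟨1, by simp, ?_⟩
        rw [max_eq_left (by linarith), abs_of_nonneg h0]
      · refine ⟨-1, by simp, ?_⟩
        rw [max_eq_left (by linarith), abs_of_nonpos h0]
        ring
  have hle : ∀ v : ℝ, max (|v| - 1) 0 ^ 2 ≤ (v - p) ^ 2 := by
    intro v
    have h0 : 0 ≤ max (|v| - 1) 0 := le_max_right _ _
    have h1 : max (|v| - 1) 0 ≤ |v - p| :=
      max_le (by linarith [abs_sub_abs_le_abs_sub v p]) (abs_nonneg _)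
    rw [← sq_abs (v - p)]
    gcongr
  have h1 := hle (y + w)
  have h2 := hle (y - w)
  unfold barrier
  rw [hyp]
  nlinarith

end Barrier

/-! ### The gap and the balance on each leaf -/

/-- The points of the complement of `F` in `(0,M) × (-4,4)` to the right of the barrier. -/
def barrierGap (M μ : ℝ) (F : Set (EuclideanSpace ℝ (Fin 2))) :
    Set (EuclideanSpace ℝ (Fin 2)) :=
  openRect 0 M (-4) 4 ∩ Fᶜ ∩ {y | barrier μ (y 1) < y 0}

theorem measurable_sub_barrier (μ : ℝ) :
    Measurable fun y : EuclideanSpace ℝ (Fin 2) => y 0 - barrier μ (y 1) := by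
  have h1 : Measurable fun x : EuclideanSpace ℝ (Fin 2) => x 1 := by fun_prop
  exact Measurable.sub (by fun_prop) ((measurable_barrier μ).comp h1)

theorem measurableSet_barrierGap (M μ : ℝ) {F : Set (EuclideanSpace ℝ (Fin 2))}
    (hF : MeasurableSet F) : MeasurableSet (barrierGap M μ F) := by
  refine ((measurableSet_openRect _ _ _ _).inter hF.compl).inter ?_
  have h1 : Measurable fun x : EuclideanSpace ℝ (Fin 2) => x 1 := by fun_prop
  exact measurableSet_lt ((measurable_barrier μ).comp h1) (by fun_prop)

section Balance

variable {s M μ R : ℝ} {F : Set (EuclideanSpace ℝ (Fin 2))}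

theorem barrierGap_bounds (hμ : 0 < μ) (hM : 4 ≤ M)
    (hright : ∀ y ∈ openRect 0 M (-M) M, μ ≤ y 0 → y ∈ F)
    {x : EuclideanSpace ℝ (Fin 2)} (hx : x ∈ barrierGap M μ F) :
    0 < x 0 ∧ x 0 < μ ∧ |x 1| < 2 := by
  obtain ⟨⟨⟨⟨h1, h2⟩, h3, h4⟩, hxF⟩, hb⟩ := hx
  have hlt : x 0 < μ := by
    by_contra! h
    exact hxF (hright x ⟨⟨h1, h2⟩, by linarith, by linarith⟩ h)
  exact ⟨h1, hlt, abs_lt_two_of_barrier_lt hμ (lt_trans hb hlt)⟩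

/-- A point right of the leaf and outside `F` has first coordinate in `(0, μ)`, which forces `|y 1|
< 2`; it is therefore inside the rectangle, hence in the gap. -/
theorem mem_of_barrier_lt (hμ : 0 < μ)
    (hright : ∀ y ∈ openRect 0 M (-M) M, μ ≤ y 0 → y ∈ F)
    {x y : EuclideanSpace ℝ (Fin 2)} (hx : x ∈ barrierGap M μ F)
    (hy0 : y 0 < M) (hy1 : |y 1| < M) (hxy : x 0 - barrier μ (x 1) < y 0 - barrier μ (y 1)) :
    y ∈ F ∪ (barrierGap M μ F ∩ {y | x 0 - barrier μ (x 1) < y 0 - barrier μ (y 1)}) := by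
  by_cases hyF : y ∈ F
  · exact Or.inl hyF
  have hxb : barrier μ (x 1) < x 0 := hx.2
  have hyb : barrier μ (y 1) < y 0 := by linarith
  have hpos : 0 < y 0 := (barrier_nonneg hμ.le _).trans_lt hyb
  have hlt : y 0 < μ := by
    by_contra! h
    exact hyF (hright y ⟨⟨hpos, hy0⟩, abs_lt.1 hy1⟩ h)
  have h2 := abs_lt.1 (abs_lt_two_of_barrier_lt hμ (hyb.trans hlt))
  exact Or.inr ⟨⟨⟨⟨⟨hpos, hy0⟩, by linarith, by linarith⟩, hyF⟩, hyb⟩, hxy⟩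

/-- At a point of the gap, the kernel integrates to more over the side of the leaf through this
point where `F` prevails than over the other side. -/
theorem setLIntegral_gap_balance (hs : 0 < s) (hF : MeasurableSet F) (hμ : 0 < μ)
    (hμ1 : μ ≤ 1 / 25) (hR : 6 ≤ R) (hM : R + 3 ≤ M)
    (hright : ∀ y ∈ openRect 0 M (-M) M, μ ≤ y 0 → y ∈ F)
    (hleft : ∀ y ∈ vertStrip (-M) 0, y 1 ≤ 0 → y ∈ F)
    {k : EuclideanSpace ℝ (Fin 2) → ENNReal} (hneg : ∀ z, k (-z) = k z)
    (hkle : ∀ z, k z ≤ fracKernel s z) (hkeq : ∀ z, 1 < ‖z‖ → k z = fracKernel s z)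
    {c : ENNReal}
    (hc : ENNReal.ofReal (2 * μ) * (∫⁻ w in Set.Ioo (-R) R, ENNReal.ofReal (|w| ^ (-s)))
      + (∫⁻ z in {z : EuclideanSpace ℝ (Fin 2) | R ≤ ‖z‖}, fracKernel s z) + c
      ≤ ∫⁻ z in openRect 1 4 3 4, fracKernel s z)
    {x : EuclideanSpace ℝ (Fin 2)} (hx : x ∈ barrierGap M μ F) :
    (∫⁻ y in (F ∪ (barrierGap M μ F ∩
        {y | x 0 - barrier μ (x 1) < y 0 - barrier μ (y 1)}))ᶜ, k (x - y)) + c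
      ≤ ∫⁻ y in F ∪ (barrierGap M μ F ∩
        {y | x 0 - barrier μ (x 1) < y 0 - barrier μ (y 1)}), k (x - y) := by
  set S := F ∪ (barrierGap M μ F ∩
    {y | x 0 - barrier μ (x 1) < y 0 - barrier μ (y 1)}) with hS
  have hSm : MeasurableSet S := hF.union ((measurableSet_barrierGap M μ hF).inter
    (measurableSet_lt measurable_const (measurable_sub_barrier μ)))
  obtain ⟨hx0, hx0μ, hx1⟩ := barrierGap_bounds hμ (by linarith) hright hx
  obtain ⟨hx1l, hx1u⟩ := abs_lt.1 hx1
  set W : Set (EuclideanSpace ℝ (Fin 2)) := {z | x - z ∈ S} with hW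
  have hWm : MeasurableSet W := (measurable_const.sub measurable_id) hSm
  have htrans : ∀ V : Set (EuclideanSpace ℝ (Fin 2)), MeasurableSet V →
      ∫⁻ y in V, k (x - y) = ∫⁻ z in {z | x - z ∈ V}, k z := by
    intro V hV
    have hVm : MeasurableSet {z | x - z ∈ V} := (measurable_const.sub measurable_id) hV
    rw [← lintegral_indicator hV, ← lintegral_indicator hVm, ← lintegral_sub_left_eq_self _ x]
    refine lintegral_congr fun z => ?_
    simp only [Set.indicator, Set.mem_ofPred_eq, sub_sub_cancel]
  rw [htrans _ hSm, htrans _ hSm.compl]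
  have hcoord : ∀ (z : EuclideanSpace ℝ (Fin 2)) (i : Fin 2), |z i| ≤ ‖z‖ := fun z i =>
    PiLp.norm_apply_le z i
  set β : ℝ → ℝ := fun w => barrier μ (x 1 + w) - barrier μ (x 1) with hβ
  set α : ℝ → ℝ := fun w => barrier μ (x 1) - barrier μ (x 1 - w) with hα
  have hβm : Measurable β := ((measurable_barrier μ).comp (by fun_prop)).sub measurable_const
  have hαm : Measurable α := measurable_const.sub ((measurable_barrier μ).comp (by fun_prop))
  set D : Set (EuclideanSpace ℝ (Fin 2)) := {z | z 1 ∈ Set.Ioo (-R) R ∧ α (z 1) ≤ z 0 ∧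
    z 0 ≤ β (z 1)} with hD
  refine setLIntegral_compl_add_le_of_even (Q := openRect 1 4 3 4) (N := D ∪ {z | R ≤ ‖z‖})
    hneg hWm c ?_ ?_ ?_
  -- Here `x - z` is in the left strip below the axis, because `x 1 < 2 < 3 < z 1`, and `x + z` is
  -- right of the leaf.
  · rintro z ⟨⟨h1, h2⟩, h3, h4⟩
    constructor
    · refine Or.inl (hleft _ ⟨?_, ?_⟩ ?_)
      · simp only [PiLp.sub_apply]; linarith
      · simp only [PiLp.sub_apply]; linarith
      · simp only [PiLp.sub_apply]; linarith
    -- `|x 1 + z 1| < 6`, so with `μ ≤ 1 / 25` the barrier there is at most `1 < z 0`.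
    · have hb : barrier μ (x 1 + z 1) ≤ μ * 5 ^ 2 :=
        barrier_le hμ.le (by norm_num) (abs_le.2 ⟨by linarith, by linarith⟩)
      have hb0 := barrier_nonneg hμ.le (x 1)
      refine mem_of_barrier_lt hμ hright hx ?_ ?_ ?_
      · simp only [sub_neg_eq_add, PiLp.add_apply]; linarith
      · simp only [sub_neg_eq_add, PiLp.add_apply]
        exact abs_lt.2 ⟨by linarith, by linarith⟩
      · simp only [sub_neg_eq_add, PiLp.add_apply]; linarith
  -- For `‖z‖ < R`, both `x ± z` are within reach of `mem_of_barrier_lt`, so neither is right of the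
  -- leaf; this says `α ≤ z 0 ≤ β`.
  · intro z hz hz'
    by_cases hzR : R ≤ ‖z‖
    · exact Or.inr hzR
    have hzR' := not_le.1 hzR
    obtain ⟨h0l, h0u⟩ := abs_lt.1 ((hcoord z 0).trans_lt hzR')
    obtain ⟨h1l, h1u⟩ := abs_lt.1 ((hcoord z 1).trans_lt hzR')
    refine Or.inl ⟨⟨h1l, h1u⟩, ?_, ?_⟩
    · by_contra! h
      simp only [hα] at h
      refine hz (mem_of_barrier_lt hμ hright hx ?_ ?_ ?_)
      · simp only [PiLp.sub_apply]; linarith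
      · simp only [PiLp.sub_apply]
        exact abs_lt.2 ⟨by linarith, by linarith⟩
      · simp only [PiLp.sub_apply]; linarith
    · by_contra! h
      simp only [hβ] at h
      refine hz' (mem_of_barrier_lt hμ hright hx ?_ ?_ ?_)
      · simp only [sub_neg_eq_add, PiLp.add_apply]; linarith
      · simp only [sub_neg_eq_add, PiLp.add_apply]
        exact abs_lt.2 ⟨by linarith, by linarith⟩
      · simp only [sub_neg_eq_add, PiLp.add_apply]; linarith
  -- The gain region lies outside the unit ball, so truncation leaves it intact and `c` is uniform.
  · have hQ : ∫⁻ z in openRect 1 4 3 4, k z = ∫⁻ z in openRect 1 4 3 4, fracKernel s z := by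
      refine setLIntegral_congr_fun (measurableSet_openRect 1 4 3 4) fun z hz => hkeq z ?_
      linarith [hz.2.1, le_abs_self (z 1), hcoord z 1]
    rw [hQ]
    refine le_trans (add_le_add_left ?_ c) hc
    refine (lintegral_mono hkle).trans ((lintegral_union_le _ _ _).trans (add_le_add_left ?_ _))
    refine setLIntegral_fracKernel_thin_le hs hαm hβm (by positivity) R fun w => ?_
    have := barrier_add_le hμ.le (x 1) w
    simp only [hα, hβ]
    linarith

end Balance

/-! ### Choice of constants and conclusion -/

theorem exists_balance_constants {s : ℝ} (hs0 : 0 < s) (hs1 : s < 1) :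
    ∃ (R μ₀ : ℝ) (c : ENNReal), 6 ≤ R ∧ 0 < μ₀ ∧ μ₀ ≤ 1 / 25 ∧ c ≠ 0 ∧
      ENNReal.ofReal (2 * μ₀) * (∫⁻ w in Set.Ioo (-R) R, ENNReal.ofReal (|w| ^ (-s)))
      + (∫⁻ z in {z : EuclideanSpace ℝ (Fin 2) | R ≤ ‖z‖}, fracKernel s z) + c
      ≤ ∫⁻ z in openRect 1 4 3 4, fracKernel s z := by
  set q := ∫⁻ z in openRect 1 4 3 4, fracKernel s z with hq
  set T := ∫⁻ z in {z : EuclideanSpace ℝ (Fin 2) | 1 ≤ ‖z‖}, fracKernel s z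
  have hT : T < ⊤ := lintegral_fracKernel_one_le_norm_lt_top hs0
  have hq0 : q ≠ 0 := by
    have hpos : 0 < q := by
      rw [hq, setLIntegral_pos_iff (measurable_fracKernel s)]
      have hsub : openRect 1 4 3 4 ⊆ Function.support (fracKernel s) ∩ openRect 1 4 3 4 := by
        refine fun z hz => ⟨?_, hz⟩
        have h1 : |z 0| ≤ ‖z‖ := PiLp.norm_apply_le z 0
        have hz0 : 0 < ‖z‖ := by linarith [hz.1.1, le_abs_self (z 0)]
        rw [Function.mem_support, fracKernel]
        exact (ENNReal.ofReal_pos.2 (by positivity)).ne'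
      refine lt_of_lt_of_le ((isOpen_openRect 1 4 3 4).measure_pos volume ?_)
        (measure_mono hsub)
      refine ⟨!₂[2, 7 / 2], ⟨?_, ?_⟩, ?_, ?_⟩ <;> norm_num
    exact hpos.ne'
  -- One third of the gain each for the tail, the thin set and `c`. `R` is fixed before `μ₀`, since
  -- the thin-set integral depends on `R`.
  have hq3 : 0 < q / 3 := ENNReal.div_pos hq0 (by simp)
  have hlimR : Filter.Tendsto (fun R : ℝ => ENNReal.ofReal (R ^ (-s)) * T) Filter.atTop
      (nhds 0) := by
    have h1 := ENNReal.tendsto_ofReal (tendsto_rpow_neg_atTop hs0)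
    have h2 := ENNReal.Tendsto.mul_const (b := T) h1 (Or.inr hT.ne)
    simpa using h2
  obtain ⟨R, hR1, hR⟩ :=
    ((hlimR.eventually (gt_mem_nhds hq3)).and (Filter.eventually_ge_atTop 6)).exists
  set L := ∫⁻ w in Set.Ioo (-R) R, ENNReal.ofReal (|w| ^ (-s))
  have hL : L < ⊤ := setLIntegral_Ioo_abs_rpow_lt_top hs1 R
  have hlimμ : Filter.Tendsto (fun μ : ℝ => ENNReal.ofReal (2 * μ) * L)
      (nhdsWithin 0 (Set.Ioi 0)) (nhds 0) := by
    have h0 : Filter.Tendsto (fun μ : ℝ => 2 * μ) (nhds 0) (nhds 0) := by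
      have : Continuous fun μ : ℝ => 2 * μ := by fun_prop
      simpa using this.tendsto 0
    have h1 := ENNReal.tendsto_ofReal (h0.mono_left (nhdsWithin_le_nhds (s := Set.Ioi 0)))
    have h2 := ENNReal.Tendsto.mul_const (b := L) h1 (Or.inr hL.ne)
    simpa using h2
  have hev : ∀ᶠ μ : ℝ in nhdsWithin 0 (Set.Ioi 0), μ ∈ Set.Ioc (0 : ℝ) (1 / 25) :=
    Ioc_mem_nhdsGT (by norm_num)
  obtain ⟨μ₀, hμ1, hμ2⟩ := ((hlimμ.eventually (gt_mem_nhds hq3)).and hev).exists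
  refine ⟨R, μ₀, q / 3, hR, hμ2.1, hμ2.2, hq3.ne', ?_⟩
  rw [lintegral_fracKernel_le_norm (by linarith)]
  calc _ ≤ q / 3 + q / 3 + q / 3 := by gcongr
    _ = q := ENNReal.add_thirds q

/-- The gap between the barrier and an `s`-minimal set is a null set. -/
theorem volume_barrierGap_eq_zero {s M μ R : ℝ} (hs0 : 0 < s) (hs1 : s < 1)
    {E F : Set (EuclideanSpace ℝ (Fin 2))} (hE : IsSMinimal s E (openRect 0 M (-4) 4))
    (hEF : E =ᵐ[volume] F) (hF : MeasurableSet F) (hμ : 0 < μ)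
    (hμ1 : μ ≤ 1 / 25) (hR : 6 ≤ R) (hM : R + 3 ≤ M)
    (hright : ∀ y ∈ openRect 0 M (-M) M, μ ≤ y 0 → y ∈ F)
    (hleft : ∀ y ∈ vertStrip (-M) 0, y 1 ≤ 0 → y ∈ F) {c : ENNReal} (hc0 : c ≠ 0)
    (hc : ENNReal.ofReal (2 * μ) * (∫⁻ w in Set.Ioo (-R) R, ENNReal.ofReal (|w| ^ (-s)))
      + (∫⁻ z in {z : EuclideanSpace ℝ (Fin 2) | R ≤ ‖z‖}, fracKernel s z) + c
      ≤ ∫⁻ z in openRect 1 4 3 4, fracKernel s z) :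
    volume (barrierGap M μ F) = 0 := by
  set A := barrierGap M μ F with hA
  have hAm : MeasurableSet A := measurableSet_barrierGap M μ hF
  have hAF : Disjoint A F := Set.disjoint_left.2 fun x hx => hx.1.2
  have hAΩ : A ⊆ openRect 0 M (-4) 4 := fun x hx => hx.1.1
  have hAfin : volume A ≠ ⊤ := by
    have hone : Measurable fun _ : ℝ => (1 : ENNReal) := measurable_const
    have h1 := setLIntegral_openRect hone hone 0 M (-4) 4
    simp only [mul_one, setLIntegral_one, Real.volume_Ioo] at h1
    refine ne_top_of_le_ne_top ?_ (measure_mono hAΩ)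
    rw [h1]
    exact ENNReal.mul_ne_top ENNReal.ofReal_ne_top ENNReal.ofReal_ne_top
  obtain ⟨hfin, hle⟩ := hE.setInteraction_le hEF hF (measurableSet_openRect _ _ _ _)
    (setInteraction_openRect_compl_ne_top hs0 hs1 _ _ _ _) hAm hAΩ hAF
  have hge : setInteraction s A (Fᶜ \ A) + c * volume A ≤ setInteraction s A F := by
    refine setInteraction_add_le_of_truncated hs0 fun m => ?_
    set k : EuclideanSpace ℝ (Fin 2) → ENNReal :=
      {z : EuclideanSpace ℝ (Fin 2) | 1 / ((m : ℝ) + 1) < ‖z‖}.indicator (fracKernel s) with hk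
    have hkm : Measurable k :=
      (measurable_fracKernel s).indicator (measurableSet_lt measurable_const measurable_norm)
    have hneg : ∀ z, k (-z) = k z := fun z => by
      simp only [hk, Set.indicator, Set.mem_ofPred_eq, norm_neg, fracKernel_neg]
    have hkle : ∀ z, k z ≤ fracKernel s z := fun z => Set.indicator_le_self _ _ z
    have hkeq : ∀ z, 1 < ‖z‖ → k z = fracKernel s z := fun z hz => by
      have hm : 1 / ((m : ℝ) + 1) ≤ 1 := by
        rw [div_le_one (by positivity)]
        linarith [Nat.cast_nonneg (α := ℝ) m]
      have hmem : z ∈ {z : EuclideanSpace ℝ (Fin 2) | 1 / ((m : ℝ) + 1) < ‖z‖} := hm.trans_lt hz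
      exact Set.indicator_of_mem hmem _
    refine le_trans (kernelInteraction_add_le_of_foliation hkm hneg
      (lintegral_truncated_fracKernel_ne_top hs0 (by positivity)) hAm hAF hAfin
      (measurable_sub_barrier μ) c fun x hx => ?_) (kernelInteraction_mono_kernel hkle)
    exact setLIntegral_gap_balance hs0 hF hμ hμ1 hR hM hright hleft hneg hkle hkeq hc hx
  have h1 : setInteraction s A F + c * volume A ≤ setInteraction s A F + 0 := by
    rw [add_zero]
    exact (add_le_add_left hle _).trans hge
  have h2 : c * volume A = 0 :=
    le_antisymm ((ENNReal.add_le_add_iff_left hfin).1 h1) zero_le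
  exact (mul_eq_zero.1 h2).resolve_left hc0

theorem proposition5 (s : ℝ) (hs0 : 0 < s) (hs1 : s < 1) (lam : ℝ) (hlam : 0 < lam) :
    ∃ M₀ μ₀ : ℝ, 1 < M₀ ∧ 0 < μ₀ ∧ μ₀ < 1 ∧
      ∀ M μ : ℝ, M₀ ≤ M → 0 < μ → μ ≤ μ₀ →
        ∀ F : Set (EuclideanSpace ℝ (Fin 2)),
          IsSMinimal s F (openRect 0 M (-4) 4) →
          volume (symmDiff (F ∩ vertStrip (-M) 0) ({x | x 1 ≤ 0} ∩ vertStrip (-M) 0)) = 0 →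
          volume ((openRect 0 M (-M) M \ F) \ vertStrip 0 μ) = 0 →
            volume (openRect 0 (M / 2) (-1) 1 \ F) = 0 ∧
              (measureInterior F ⊆ F → openRect 0 (M / 2) (-1) 1 ⊆ F) := by
  obtain ⟨R, μ₀, c, hR, hμ₀, hμ₀1, hc0, hc⟩ := exists_balance_constants hs0 hs1
  refine ⟨R + 3, μ₀, by linarith, hμ₀, by linarith, ?_⟩
  intro M μ hM hμ hμle F hmin hL hRt
  have hnull : volume (openRect 0 (M / 2) (-1) 1 \ F) = 0 := by
    have hmc : Measurable fun x : EuclideanSpace ℝ (Fin 2) => x 0 := by fun_prop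
    have hmc1 : Measurable fun x : EuclideanSpace ℝ (Fin 2) => x 1 := by fun_prop
    set P : Set (EuclideanSpace ℝ (Fin 2)) := openRect 0 M (-M) M ∩ {y | μ ≤ y 0} with hP
    set N : Set (EuclideanSpace ℝ (Fin 2)) := vertStrip (-M) 0 ∩ {y | y 1 ≤ 0} with hN
    have hPm : MeasurableSet P :=
      (measurableSet_openRect _ _ _ _).inter (measurableSet_le measurable_const hmc)
    have hNm : MeasurableSet N :=
      (hmc measurableSet_Ioo).inter (measurableSet_le hmc1 measurable_const)
    have hP0 : volume (P \ F) = 0 := by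
      refine measure_mono_null ?_ hRt
      rintro y ⟨⟨hy1, hy2⟩, hy3⟩
      exact ⟨⟨hy1, hy3⟩, fun h => absurd h.2 (not_lt.2 hy2)⟩
    have hN0 : volume (N \ F) = 0 := by
      refine measure_mono_null ?_ hL
      rintro y ⟨⟨hy1, hy2⟩, hy3⟩
      exact Or.inr ⟨⟨hy2, hy1⟩, fun h => hy3 h.1⟩
    -- Changing `F` on a null set makes it measurable and makes the needed inclusions hold at every
    -- point.
    obtain ⟨F₀, hsub, hF₀m, hF₀⟩ := hmin.1.exists_measurable_superset_ae_eq
    set F₁ := F₀ ∪ P ∪ N with hF₁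
    have hdiff : volume (F₁ \ F) = 0 := by
      rw [hF₁, Set.union_sdiff_distrib, Set.union_sdiff_distrib]
      exact measure_union_null (measure_union_null (ae_eq_set.1 hF₀).1 hP0) hN0
    have hFF₁ : F =ᵐ[volume] F₁ := by
      refine ae_eq_set.2 ⟨?_, hdiff⟩
      rw [Set.sdiff_eq_empty.2 (hsub.trans (Set.subset_union_left.trans Set.subset_union_left))]
      exact measure_empty
    have hgap := volume_barrierGap_eq_zero hs0 hs1 hmin hFF₁
      ((hF₀m.union hPm).union hNm) hμ (hμle.trans hμ₀1) hR hM
      (fun y hy hyμ => Or.inl (Or.inr ⟨hy, hyμ⟩)) (fun y hy hy1 => Or.inr ⟨hy, hy1⟩) hc0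
      -- The balance for `μ₀` implies that for smaller `μ`, with the same `c`.
      (le_trans (by gcongr) hc)
    refine measure_mono_null ?_ (measure_union_null hgap hdiff)
    rintro y ⟨⟨⟨h1, h2⟩, h3, h4⟩, hyF⟩
    by_cases hy : y ∈ F₁
    · exact Or.inr ⟨hy, hyF⟩
    · refine Or.inl ⟨⟨⟨⟨h1, by linarith⟩, by linarith, by linarith⟩, hy⟩, ?_⟩
      change barrier μ (y 1) < y 0
      rw [barrier_eq_zero μ (abs_le.2 ⟨h3.le, h4.le⟩)]
      exact h1
  refine ⟨hnull, fun hF x hx => hF ?_⟩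
  obtain ⟨r, hr, hball⟩ := Metric.isOpen_iff.1 (isOpen_openRect 0 (M / 2) (-1) 1) x hx
  exact ⟨r, hr, measure_mono_null (Set.sdiff_subset_sdiff_left hball) hnull⟩
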